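/- Let $m,\mu_1,\mu_2,V,\varepsilon>0$ be real numbers and $\alpha=\mu_1/\mu_2$. For $\xi\in\mathbb{R}$ put $Y=\frac{m}{\mu_2}(\varepsilon+\mathrm{i}\xi V)^2$ and, for $j=1,2$, with principal square roots, $$z_j=\Big(1+2\alpha\sin^2\tfrac{\xi}{2}+\tfrac{2}{3}Y\Big)\cos\tfrac{\xi}{2}+(-1)^j\Big[\tfrac{Y^2}{9}-4\sin^2\tfrac{\xi}{2}\Big(\alpha\sin^2\tfrac{\xi}{2}+\tfrac{Y}{3}\Big)\Big(\alpha\sin^2\tfrac{\xi}{2}+\tfrac{Y}{3}+1-\alpha\Big)\Big]^{1/2},$$ $\Lambda_j^*=z_j-\sqrt{z_j^2-1}$, $r_j=1$ if $|\Lambda_j^*|\le 1$ and $r_j=-1$ otherwise, and $$F(z)=3\big(\cos\tfrac{\xi}{2}-z\big)^2+6\alpha\sin^2\tfrac{\xi}{2}\,\big(1+\cos\tfrac{\xi}{2}\big)(1-z)+Y\big[1-z\cos\tfrac{\xi}{2}+(1+\cos\tfrac{\xi}{2})(1-z)\big].$$ Let $$L(\xi)=L(\varepsilon+\mathrm{i}\xi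 V,\xi)=\frac{3r_1r_2(z_2-z_1)\sqrt{z_1^2-1}\sqrt{z_2^2-1}}{r_1F(z_2)\sqrt{z_1^2-1}-r_2F(z_1)\sqrt{z_2^2-1}},$$ where at a point $\xi$ with $z_1=z_2=z$ this removable singularity is given its limiting value $3w^2/\big(wF'(z)-zF(z)/w\big)$, $w=r_1\sqrt{z^2-1}$. Then $L$ is continuous on $\mathbb{R}$, has no zeros there, has even real part and odd imaginary part, and $L(\xi)\to1$ as $\xi\to\pm\infty$. Its index is zero: for a continuous argument $\arg L$ of $L$ along $\mathbb{R}$, the limits $\arg L(\pm\infty)$ exist and $$\mathrm{Ind}(L)=\frac{1}{2\pi}\big[\arg L(+\infty)-\arg L(-\infty)\big]=0 .$$ Consequently $L=L_+L_-$: there is a continuous logarithm $\ln L$ on $\mathbb{R}$ that tends to $0$ at $\pm\infty$; it is integrable; the functions $$L_\pm(\zeta)=\exp\Big(\pm\frac{1}{2\pi\mathrm{i}}\int_{-\infty}^{\infty}\frac{\ln L(s)}{s-\zeta}\,ds\Big)\qquad(\pm\operatorname{Im}\zeta>0)$$ are analytic in the open upper ($L_+$) and lower ($L_-$) half-plane;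 and $\lim_{\delta\to0+}L_+(\xi+\mathrm{i}\delta)\,L_-(\xi-\mathrm{i}\delta)=L(\xi)$ for every $\xi\in\mathbb{R}$. -/

import Mathlib

open Filter Topology MeasureTheory

noncomputable section

namespace LatticeCrack

/-! ### The kernel

Parameters: particle mass `m`, stiffness `μ₁` of the horizontal bonds and `μ₂` of the inclined
bonds, crack speed `V`, regularisation parameter `ε`; `ξ` is the wavenumber. -/

/-- The term `(m / μ₂) (ε + i ξ V)²`. -/
def inertia (m μ₂ V ε ξ : ℝ) : ℂ :=
  (m / μ₂ : ℂ) * ((ε : ℂ) + Complex.I * ξ * V) ^ 2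

/-- The expression under the square root in `z₁`, `z₂`. -/
def disc (m μ₁ μ₂ V ε ξ : ℝ) : ℂ :=
  let α : ℂ := μ₁ / μ₂
  let s : ℂ := Complex.sin (ξ / 2) ^ 2
  let Y : ℂ := inertia m μ₂ V ε ξ
  Y ^ 2 / 9 - 4 * s * (α * s + Y / 3) * (α * s + Y / 3 + 1 - α)

/-- The functions `z₁`, `z₂`, i.e. `z_j` for `j = 1, 2`. -/
def zfun (m μ₁ μ₂ V ε : ℝ) (j : ℕ) (ξ : ℝ) : ℂ :=
  (1 + 2 * (μ₁ / μ₂ : ℂ) * Complex.sin (ξ / 2) ^ 2 + 2 * inertia m μ₂ V ε ξ / 3)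
      * Complex.cos (ξ / 2)
    + (-1) ^ j * Complex.sqrt (disc m μ₁ μ₂ V ε ξ)

/-- `Λ* = z - √(z² - 1)`. -/
def lamStar (z : ℂ) : ℂ := z - Complex.sqrt (z ^ 2 - 1)

/-- `r(Λ) = 1` if `|Λ| ≤ 1`, and `-1` otherwise. -/
def rsign (Λ : ℂ) : ℂ := if ‖Λ‖ ≤ 1 then 1 else -1

/-- The function `F(z)`, which also depends on `ξ` and the parameters. -/
def Ffun (m μ₁ μ₂ V ε ξ : ℝ) (z : ℂ) : ℂ :=
  let c : ℂ := Complex.cos (ξ / 2)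
  3 * (c - z) ^ 2
    + 6 * (μ₁ / μ₂ : ℂ) * Complex.sin (ξ / 2) ^ 2 * (1 + c) * (1 - z)
    + inertia m μ₂ V ε ξ * (1 - z * c + (1 + c) * (1 - z))

/-- The kernel `L(ε + iξV, ξ)` as a function of `ξ`.

Where `z₁ ≠ z₂` this is the quotient
`3 r₁ r₂ (z₂ - z₁) √(z₁² - 1) √(z₂² - 1) / (r₁ F(z₂) √(z₁² - 1) - r₂ F(z₁) √(z₂² - 1))`,
`r_j = r(Λ_j*)`. Where `z₁ = z₂ = z`, that quotient has a removable singularity `0 / 0`; with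
`w = r(Λ*) √(z² - 1)` its limiting value is `3 w² / (w F'(z) - F(z) z / w)`. -/
def kernel (m μ₁ μ₂ V ε : ℝ) (ξ : ℝ) : ℂ :=
  let z₁ : ℂ := zfun m μ₁ μ₂ V ε 1 ξ
  let z₂ : ℂ := zfun m μ₁ μ₂ V ε 2 ξ
  let r₁ : ℂ := rsign (lamStar z₁)
  let r₂ : ℂ := rsign (lamStar z₂)
  let S₁ : ℂ := Complex.sqrt (z₁ ^ 2 - 1)
  let S₂ : ℂ := Complex.sqrt (z₂ ^ 2 - 1)
  let F : ℂ → ℂ := Ffun m μ₁ μ₂ V ε ξ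
  if z₁ = z₂ then
    3 * (r₁ * S₁) ^ 2 / (r₁ * S₁ * deriv F z₁ - F z₁ * z₁ / (r₁ * S₁))
  else
    3 * r₁ * r₂ * (z₂ - z₁) * S₁ * S₂ / (r₁ * F z₂ * S₁ - r₂ * F z₁ * S₂)

/-! ### The class `𝒥`, the index, and the factors -/

/-- Functions `ℝ → ℂ` with even real part and odd imaginary part. -/
def classJ : Set (ℝ → ℂ) :=
  {f | ∀ ξ : ℝ, (f ξ).re = (f (-ξ)).re ∧ (f ξ).im = -(f (-ξ)).im}

/-- `θ` is a continuous argument of `f` along the real line. -/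
def IsContinuousArg (f : ℝ → ℂ) (θ : ℝ → ℝ) : Prop :=
  Continuous θ ∧ ∀ ξ : ℝ, f ξ = (‖f ξ‖ : ℂ) * Complex.exp (Complex.I * θ ξ)

/-- `f` vanishes nowhere on the real line and has the index (winding number about the origin)
`κ = (arg f(+∞) - arg f(-∞)) / (2π)`, for a continuous argument of `f`. Since two continuous
arguments of `f` differ by a constant, `κ` does not depend on the choice of the argument. -/
def HasIndex (f : ℝ → ℂ) (κ : ℝ) : Prop :=
  (∀ ξ : ℝ, f ξ ≠ 0) ∧
  ∃ (θ : ℝ → ℝ) (a b : ℝ), IsContinuousArg f θ ∧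
    Tendsto θ atBot (𝓝 a) ∧ Tendsto θ atTop (𝓝 b) ∧ (b - a) / (2 * Real.pi) = κ

/-- `ℓ` is the continuous logarithm of `f` that vanishes at `±∞`. -/
def IsLogVanishingAtInfinity (f ℓ : ℝ → ℂ) : Prop :=
  Continuous ℓ ∧ (∀ ξ : ℝ, Complex.exp (ℓ ξ) = f ξ) ∧
    Tendsto ℓ atBot (𝓝 0) ∧ Tendsto ℓ atTop (𝓝 0)

/-- `(1 / (2πi)) ∫ ℓ(s) / (s - ζ) ds` over the real line. -/
def cauchyIntegral (ℓ : ℝ → ℂ) (ζ : ℂ) : ℂ :=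
  1 / (2 * Real.pi * Complex.I) * ∫ s : ℝ, ℓ s / ((s : ℂ) - ζ)

/-- The factor `L₊(ζ)`, for `Im ζ > 0`; `ℓ` stands for `ln L`. -/
def factorPlus (ℓ : ℝ → ℂ) (ζ : ℂ) : ℂ := Complex.exp (cauchyIntegral ℓ ζ)

/-- The factor `L₋(ζ)`, for `Im ζ < 0`; `ℓ` stands for `ln L`. -/
def factorMinus (ℓ : ℝ → ℂ) (ζ : ℂ) : ℂ := Complex.exp (-cauchyIntegral ℓ ζ)

end LatticeCrack

end

namespace LatticeCrack

/-! ### The branch of `√(z² - 1)` outside `[-1, 1]` -/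

/-! The proof replaces the branch-dependent formula for the kernel by an average over the transverse
wavenumber. With `c = cos (ξ / 2)` and `Y` the inertia term, `z₁` and `z₂` are the roots in `x` of
the dispersion polynomial `disp`, and `F` is the surface symbol `symF`. Evaluating the integrals of
`(z - cos θ)⁻¹` by residues gives `1 / L = 1 - (2π)⁻¹ ∫ symF / disp` at `x = cos θ`, also when `z₁ =
z₂` (`kernel_eq_inv_recipKernel`). The signs `r_j` select the pole inside the unit circle.

As a polynomial in `Y`, `disp` has only real nonpositive roots, so the integrand is continuous
whenever `Y` avoids `(-∞, 0]`, as it does for `ε, V > 0`. The Rayleigh quotient bound `rayleigh_le`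
makes `1 / L` a Nevanlinna-type function of `Y`: its imaginary part has the sign of `Im Y`
(`im_recipKernel_mul_im_pos`). At `ξ = 0`, where `Y` is real, `1 / L` is a positive average. Hence
`1 / L` never meets `(-∞, 0]`, and `ℓ = -log (1 / L)` with the principal logarithm is continuous.

Since `|Y|` grows like `ξ²`, `1 / L = 1 + O(ξ⁻²)`. So `ℓ` is integrable and vanishes at infinity,
which gives index zero. The factorization is the Plemelj jump relation, obtained from the Poisson
kernel. -/

theorem complex_sqrt_sq (z : ℂ) : Complex.sqrt z ^ 2 = z := by
  exact_mod_cast Complex.cpow_nat_inv_pow z two_ne_zero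

/-- On the unit circle the inverse is the conjugate, so `2 * z = a + b` would be `2 * Re a`, putting
`z` in `[-1, 1]`. -/
theorem norm_ne_one_of_mul_eq_one {z a b : ℂ} (hz : ∀ x ∈ Set.Icc (-1 : ℝ) 1, z ≠ x)
    (hab : a * b = 1) (hsum : a + b = 2 * z) : ‖a‖ ≠ 1 := by
  intro ha
  have hb : b = (starRingEnd ℂ) a := by
    have h1 : a * (starRingEnd ℂ) a = 1 := by
      rw [Complex.mul_conj, Complex.normSq_eq_norm_sq, ha]; simp
    have ha0 : a ≠ 0 := by rintro rfl; simp at ha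
    exact mul_left_cancel₀ ha0 (hab.trans h1.symm)
  rw [hb, Complex.add_conj] at hsum
  have hre := Complex.abs_re_le_norm a
  rw [ha] at hre
  refine hz a.re (abs_le.mp hre) ?_
  push_cast at hsum
  exact (mul_left_cancel₀ two_ne_zero hsum).symm

/-- Outside `[-1, 1]` the signed root `r √(z² - 1)` is the one with `|z - r √(z² - 1)| < 1`. -/
theorem rsign_mul_sqrt_spec {z : ℂ} (hz : ∀ x ∈ Set.Icc (-1 : ℝ) 1, z ≠ x) :
    (rsign (lamStar z) * Complex.sqrt (z ^ 2 - 1)) ^ 2 = z ^ 2 - 1 ∧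
      ‖z - rsign (lamStar z) * Complex.sqrt (z ^ 2 - 1)‖ < 1 := by
  set S := Complex.sqrt (z ^ 2 - 1) with hS
  have hS2 : S ^ 2 = z ^ 2 - 1 := complex_sqrt_sq _
  have hab : (z - S) * (z + S) = 1 := by linear_combination -hS2
  have hne := norm_ne_one_of_mul_eq_one hz hab (by ring)
  unfold rsign lamStar
  rw [← hS]
  split_ifs with h
  · exact ⟨by linear_combination hS2, by simpa using lt_of_le_of_ne h hne⟩
  · refine ⟨by linear_combination hS2, ?_⟩
    have hn : ‖z - S‖ * ‖z + S‖ = 1 := by rw [← norm_mul, hab, norm_one]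
    rw [show z - -1 * S = z + S by ring]
    push Not at h
    nlinarith [norm_nonneg (z + S)]

/-! ### Integrals of powers of `(z - cos θ)⁻¹` -/

/-- Substituting `ζ = exp (iθ)` turns the integrand into a rational function with simple poles `z -
w` inside the unit circle and `z + w` outside; Cauchy's formula is applied at the inner pole. -/
theorem integral_inv_sub_cos {z w : ℂ} (hw : w ^ 2 = z ^ 2 - 1) (hlt : ‖z - w‖ < 1) :
    ∫ θ in (0 : ℝ)..2 * Real.pi, (z - Real.cos θ)⁻¹ = 2 * Real.pi / w := by
  have hab : (z - w) * (z + w) = 1 := by linear_combination -hw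
  have hn : ‖z - w‖ * ‖z + w‖ = 1 := by rw [← norm_mul, hab, norm_one]
  have hb : 1 < ‖z + w‖ := by nlinarith [norm_nonneg (z + w), norm_nonneg (z - w)]
  have hw0 : w ≠ 0 := by
    rintro rfl
    simp only [sub_zero, add_zero] at hlt hb
    linarith
  have hcb : ∀ ζ ∈ Metric.closedBall (0 : ℂ) 1, ζ - (z + w) ≠ 0 := by
    intro ζ hζ h
    rw [mem_closedBall_zero_iff, sub_eq_zero.mp h] at hζ
    linarith
  have hd : DifferentiableOn ℂ (fun ζ : ℂ => 2 * Complex.I / (ζ - (z + w)))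
      (Metric.closedBall 0 1) := by
    intro ζ hζ
    have := hcb ζ hζ
    exact (by fun_prop (disch := assumption) :
      DifferentiableAt ℂ (fun ζ : ℂ => 2 * Complex.I / (ζ - (z + w))) ζ).differentiableWithinAt
  have hC := hd.circleIntegral_sub_inv_smul (w := z - w) (by simpa using hlt)
  have hval : ∫ θ in (0 : ℝ)..2 * Real.pi, (z - Real.cos θ)⁻¹ =
      ∮ ζ in C(0, 1), (ζ - (z - w))⁻¹ • (2 * Complex.I / (ζ - (z + w))) := by
    rw [circleIntegral]
    refine intervalIntegral.integral_congr fun θ _ => ?_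
    simp only [deriv_circleMap, smul_eq_mul]
    set e := circleMap 0 1 θ with he
    have he1 : ‖e‖ = 1 := by simp [he]
    have he0 : e ≠ 0 := by intro h; simp [h] at he1
    have h1 : e - (z + w) ≠ 0 := hcb e (by simp [he1])
    have h2 : e - (z - w) ≠ 0 := by
      intro h
      rw [sub_eq_zero.mp h] at he1
      linarith
    have hcos : (Real.cos θ : ℂ) = (e + e⁻¹) / 2 := by
      rw [he, circleMap, Complex.ofReal_cos, Complex.cos]
      simp [Complex.exp_neg]
    have h3 : z - (Real.cos θ : ℂ) = -((e - (z - w)) * (e - (z + w))) / (2 * e) := by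
      rw [hcos]
      field_simp
      linear_combination hab
    rw [h3]
    field_simp
    linear_combination (-1 : ℂ) * Complex.I_sq
  rw [hval, hC]
  simp only [smul_eq_mul]
  rw [show z - w - (z + w) = -(2 * w) by ring]
  field_simp
  linear_combination (-1 : ℂ) * Complex.I_sq

/-- The same substitution now gives a double pole at `z - w`, hence Cauchy's formula for the first
derivative. -/
theorem integral_inv_sub_cos_sq {z w : ℂ} (hw : w ^ 2 = z ^ 2 - 1) (hlt : ‖z - w‖ < 1) :
    ∫ θ in (0 : ℝ)..2 * Real.pi, ((z - Real.cos θ) ^ 2)⁻¹ = 2 * Real.pi * z / w ^ 3 := by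
  have hab : (z - w) * (z + w) = 1 := by linear_combination -hw
  have hn : ‖z - w‖ * ‖z + w‖ = 1 := by rw [← norm_mul, hab, norm_one]
  have hb : 1 < ‖z + w‖ := by nlinarith [norm_nonneg (z + w), norm_nonneg (z - w)]
  have hw0 : w ≠ 0 := by
    rintro rfl
    simp only [sub_zero, add_zero] at hlt hb
    linarith
  set b := z + w with hbdef
  set U : Set ℂ := {b}ᶜ with hU
  have hUo : IsOpen U := isOpen_compl_singleton
  have hcb : Metric.closedBall (0 : ℂ) 1 ⊆ U := by
    intro ζ hζ h
    rw [mem_closedBall_zero_iff, Set.mem_singleton_iff.mp h] at hζ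
    linarith
  have hder : ∀ ζ ∈ U, HasDerivAt (fun ζ : ℂ => -4 * Complex.I * ζ / (ζ - b) ^ 2)
      (4 * Complex.I * (ζ + b) / (ζ - b) ^ 3) ζ := by
    intro ζ hζ
    have h0 : ζ - b ≠ 0 := sub_ne_zero.mpr hζ
    have h := ((hasDerivAt_id ζ).const_mul (-4 * Complex.I)).div
      (((hasDerivAt_id ζ).sub_const b).pow 2) (pow_ne_zero 2 h0)
    refine h.congr_deriv ?_
    simp only [id, Pi.pow_apply]
    push_cast
    field_simp
    ring
  have hd : DifferentiableOn ℂ (fun ζ : ℂ => -4 * Complex.I * ζ / (ζ - b) ^ 2) U :=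
    fun ζ hζ => (hder ζ hζ).differentiableAt.differentiableWithinAt
  have hmem : z - w ∈ Metric.ball (0 : ℂ) 1 := by simpa using hlt
  have hC := Complex.two_pi_I_inv_smul_circleIntegral_sub_sq_inv_smul_of_differentiable
    hUo hcb hd hmem
  rw [(hder _ (hcb (Metric.ball_subset_closedBall hmem))).deriv] at hC
  have hval : ∫ θ in (0 : ℝ)..2 * Real.pi, ((z - Real.cos θ) ^ 2)⁻¹ =
      ∮ ζ in C(0, 1), ((ζ - (z - w)) ^ 2)⁻¹ • (-4 * Complex.I * ζ / (ζ - b) ^ 2) := by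
    rw [circleIntegral]
    refine intervalIntegral.integral_congr fun θ _ => ?_
    simp only [deriv_circleMap, smul_eq_mul]
    set e := circleMap 0 1 θ with he
    have he1 : ‖e‖ = 1 := by simp [he]
    have he0 : e ≠ 0 := by intro h; simp [h] at he1
    have h1 : e - b ≠ 0 := sub_ne_zero.mpr (hcb (by simp [he1]))
    have h2 : e - (z - w) ≠ 0 := by
      intro h
      rw [sub_eq_zero.mp h] at he1
      linarith
    have hcos : (Real.cos θ : ℂ) = (e + e⁻¹) / 2 := by
      rw [he, circleMap, Complex.ofReal_cos, Complex.cos]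
      simp [Complex.exp_neg]
    have h3 : z - (Real.cos θ : ℂ) = -((e - (z - w)) * (e - b)) / (2 * e) := by
      rw [hcos]
      field_simp
      linear_combination hab
    rw [h3]
    field_simp
    linear_combination (4 : ℂ) * Complex.I_sq
  rw [smul_eq_mul, inv_mul_eq_iff_eq_mul₀ Complex.two_pi_I_ne_zero] at hC
  rw [hval, hC, hbdef, show z - w - (z + w) = -(2 * w) by ring]
  field_simp
  linear_combination (-8 : ℂ) * z * Complex.I_sq

/-! ### The dispersion polynomial and the surface symbol

For `c = cos (ξ / 2)` and `x = cos η`, `Y² + traceD Y + detD` is the determinant of `Y + D`, `D` the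
dynamical matrix of the intact lattice, and `symF₁ Y + symF₀` is half the quadratic form of the
adjugate of `Y + D` at the vector of the inclined bonds. -/

def traceD (α c x : ℝ) : ℝ := 4 * α * (1 - c ^ 2) + 4 * (1 - c * x)

def detD (α c x : ℝ) : ℝ := 12 * α * (1 - c ^ 2) * (1 - c * x) + 3 * (c - x) ^ 2

def symF₁ (c x : ℝ) : ℝ := 1 - c * x + (1 + c) * (1 - x)

def symF₀ (α c x : ℝ) : ℝ := 3 * (c - x) ^ 2 + 6 * α * (1 - c ^ 2) * (1 + c) * (1 - x)

def disp (α c : ℝ) (Y : ℂ) (x : ℝ) : ℂ := Y ^ 2 + traceD α c x * Y + detD α c x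

def symF (α c : ℝ) (Y : ℂ) (x : ℝ) : ℂ := symF₁ c x * Y + symF₀ α c x

theorem mul_le_one_of_mem_Icc {c x : ℝ} (hc : c ∈ Set.Icc (-1 : ℝ) 1)
    (hx : x ∈ Set.Icc (-1 : ℝ) 1) : c * x ≤ 1 := by
  obtain ⟨h1, h2⟩ := hc
  obtain ⟨h3, h4⟩ := hx
  nlinarith [mul_nonneg (sub_nonneg.2 h1) (sub_nonneg.2 h4),
    mul_nonneg (sub_nonneg.2 h2) (sub_nonneg.2 h3)]

theorem one_sub_sq_nonneg_of_mem_Icc {c : ℝ} (hc : c ∈ Set.Icc (-1 : ℝ) 1) : 0 ≤ 1 - c ^ 2 := by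
  nlinarith [hc.1, hc.2]

theorem traceD_nonneg {α c x : ℝ} (hα : 0 ≤ α) (hc : c ∈ Set.Icc (-1 : ℝ) 1)
    (hx : x ∈ Set.Icc (-1 : ℝ) 1) : 0 ≤ traceD α c x := by
  have h1 := mul_le_one_of_mem_Icc hc hx
  have h2 := mul_nonneg hα (one_sub_sq_nonneg_of_mem_Icc hc)
  unfold traceD
  linarith

theorem detD_nonneg {α c x : ℝ} (hα : 0 ≤ α) (hc : c ∈ Set.Icc (-1 : ℝ) 1)
    (hx : x ∈ Set.Icc (-1 : ℝ) 1) : 0 ≤ detD α c x := by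
  have h1 := mul_le_one_of_mem_Icc hc hx
  have h2 := mul_nonneg (mul_nonneg hα (one_sub_sq_nonneg_of_mem_Icc hc)) (sub_nonneg.2 h1)
  unfold detD
  nlinarith [sq_nonneg (c - x)]

/-- The difference is the square below plus `12 (1 - c²)(1 - x²)`, because `(1 - cx)² - (c - x)² =
(1 - c²)(1 - x²)`. -/
theorem four_mul_detD_le {α c x : ℝ} (hc : c ∈ Set.Icc (-1 : ℝ) 1)
    (hx : x ∈ Set.Icc (-1 : ℝ) 1) : 4 * detD α c x ≤ traceD α c x ^ 2 := by
  have h := mul_nonneg (one_sub_sq_nonneg_of_mem_Icc hc) (one_sub_sq_nonneg_of_mem_Icc hx)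
  unfold detD traceD
  nlinarith [sq_nonneg (4 * α * (1 - c ^ 2) - 2 * (1 - c * x))]

theorem symF₁_nonneg {c x : ℝ} (hc : c ∈ Set.Icc (-1 : ℝ) 1)
    (hx : x ∈ Set.Icc (-1 : ℝ) 1) : 0 ≤ symF₁ c x := by
  have h1 := mul_le_one_of_mem_Icc hc hx
  have h2 := mul_nonneg (neg_le_iff_add_nonneg'.1 hc.1) (sub_nonneg.2 hx.2)
  unfold symF₁
  linarith

theorem symF₀_nonneg {α c x : ℝ} (hα : 0 ≤ α) (hc : c ∈ Set.Icc (-1 : ℝ) 1)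
    (hx : x ∈ Set.Icc (-1 : ℝ) 1) : 0 ≤ symF₀ α c x := by
  have h2 := mul_nonneg (mul_nonneg hα (one_sub_sq_nonneg_of_mem_Icc hc))
    (mul_nonneg (neg_le_iff_add_nonneg'.1 hc.1) (sub_nonneg.2 hx.2))
  unfold symF₀
  nlinarith [sq_nonneg (c - x)]

/-- The Rayleigh quotient of the bond vector lies between the eigenvalues of `D`. -/
theorem rayleigh_le {α c x : ℝ} (hc : c ∈ Set.Icc (-1 : ℝ) 1) (hx : x ∈ Set.Icc (-1 : ℝ) 1) :
    symF₀ α c x ^ 2 + symF₁ c x ^ 2 * detD α c x ≤ symF₀ α c x * symF₁ c x * traceD α c x := by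
  -- For `ρ = symF₀ / symF₁` the claim is `ρ² - traceD ρ + detD ≤ 0` with denominators cleared; the
  -- defect is 3/4 of this product.
  have h := mul_nonneg (mul_nonneg (one_sub_sq_nonneg_of_mem_Icc hc)
    (one_sub_sq_nonneg_of_mem_Icc hx))
    (sq_nonneg ((1 - c) * (1 + x) - 3 * (1 + c) * (1 - x)
      + (2 * (1 - c * x) - 4 * α * (1 - c ^ 2))))
  have key : symF₀ α c x * symF₁ c x * traceD α c x -
      (symF₀ α c x ^ 2 + symF₁ c x ^ 2 * detD α c x) = 3 / 4 * ((1 - c ^ 2) * (1 - x ^ 2) *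
      ((1 - c) * (1 + x) - 3 * (1 + c) * (1 - x) + (2 * (1 - c * x) - 4 * α * (1 - c ^ 2))) ^ 2) := by
    unfold symF₀ symF₁ detD traceD
    ring
  linarith

/-- Nonnegative coefficients and discriminant force both roots to be real and nonpositive, off the
slit plane. -/
theorem quadratic_ne_zero {t d : ℝ} (ht : 0 ≤ t) (hd : 0 ≤ d) (htd : 4 * d ≤ t ^ 2) {Y : ℂ}
    (hY : Y ∈ Complex.slitPlane) : Y ^ 2 + t * Y + d ≠ 0 := by
  intro h
  have hre := congrArg Complex.re h
  have him := congrArg Complex.im h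
  simp [pow_two] at hre him
  by_cases hi : Y.im = 0
  · rw [Complex.mem_slitPlane_iff] at hY
    have hp : 0 < Y.re := hY.resolve_right (by simpa using hi)
    rw [hi] at hre
    nlinarith [mul_nonneg ht hp.le]
  · have h2 : 2 * Y.re + t = 0 := mul_left_cancel₀ hi (by linarith)
    have h3 : 0 < Y.im * Y.im := mul_self_pos.2 hi
    have h4 : Y.re = -t / 2 := by linarith
    rw [h4] at hre
    nlinarith

theorem disp_ne_zero {α c x : ℝ} (hα : 0 ≤ α) (hc : c ∈ Set.Icc (-1 : ℝ) 1)
    (hx : x ∈ Set.Icc (-1 : ℝ) 1) {Y : ℂ} (hY : Y ∈ Complex.slitPlane) : disp α c Y x ≠ 0 :=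
  quadratic_ne_zero (traceD_nonneg hα hc hx) (detD_nonneg hα hc hx) (four_mul_detD_le hc hx) hY

/-- A Nevanlinna-type sign property of the quotient `F / P`. -/
theorem im_symF_mul_conj_disp (α c x : ℝ) (Y : ℂ) :
    (symF α c Y x * (starRingEnd ℂ) (disp α c Y x)).im =
      -(Y.im * (symF₁ c x * (Y.re ^ 2 + Y.im ^ 2) + 2 * symF₀ α c x * Y.re
        + symF₀ α c x * traceD α c x - symF₁ c x * detD α c x)) := by
  unfold symF disp
  simp [pow_two]
  ring

/-- Multiplied by `symF₁`, the expression is `(symF₁ X + symF₀)² + symF₁² T²` plus the nonnegative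
defect in `rayleigh_le`. -/
theorem nevanlinna_factor_pos {α c x : ℝ} (hc : c ∈ Set.Icc (-1 : ℝ) 1)
    (hx : x ∈ Set.Icc (-1 : ℝ) 1) {X T : ℝ} (hT : T ≠ 0) (hf : 0 < symF₁ c x) :
    0 < symF₁ c x * (X ^ 2 + T ^ 2) + 2 * symF₀ α c x * X
        + symF₀ α c x * traceD α c x - symF₁ c x * detD α c x := by
  have h := rayleigh_le (α := α) hc hx
  have h2 : 0 < symF₁ c x ^ 2 * T ^ 2 := by positivity
  refine (mul_pos_iff_of_pos_left hf).1 ?_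
  nlinarith [sq_nonneg (symF₁ c x * X + symF₀ α c x)]

theorem symF_eq_zero_of_symF₁_eq_zero {α c x : ℝ} (hc : c ∈ Set.Icc (-1 : ℝ) 1)
    (hx : x ∈ Set.Icc (-1 : ℝ) 1) (hf : symF₁ c x = 0) : symF₀ α c x = 0 := by
  have h := rayleigh_le (α := α) hc hx
  rw [hf] at h
  nlinarith [sq_nonneg (symF₀ α c x)]

theorem im_symF_mul_conj_disp_mul_im_nonpos {α c x : ℝ} (hc : c ∈ Set.Icc (-1 : ℝ) 1)
    (hx : x ∈ Set.Icc (-1 : ℝ) 1) (Y : ℂ) :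
    (symF α c Y x * (starRingEnd ℂ) (disp α c Y x)).im * Y.im ≤ 0 := by
  rcases (symF₁_nonneg hc hx).eq_or_lt with hf | hf
  · simp [symF, ← hf, symF_eq_zero_of_symF₁_eq_zero hc hx hf.symm]
  · by_cases hT : Y.im = 0
    · simp [hT]
    · rw [im_symF_mul_conj_disp]
      nlinarith [mul_pos (nevanlinna_factor_pos (α := α) (X := Y.re) hc hx hT hf)
        (show 0 < Y.im ^ 2 by positivity)]

/-! ### The reciprocal kernel as an integral over the transverse wavenumber -/

theorem continuous_inv_sub_cos_pow {z : ℂ} (hz : ∀ x ∈ Set.Icc (-1 : ℝ) 1, z ≠ x) (n : ℕ) :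
    Continuous fun θ : ℝ => ((z - Real.cos θ) ^ n)⁻¹ := by
  refine Continuous.inv₀ (by fun_prop) fun θ => pow_ne_zero _ ?_
  exact sub_ne_zero.2 (hz _ (Real.cos_mem_Icc θ))

/-- Partial fractions. Both leading coefficients are 3, so the polynomial part is 1; it cancels the
1 in `recipKernel`. -/
theorem integral_quadratic_div_of_ne {z₁ z₂ w₁ w₂ : ℂ} (p q : ℂ)
    (hz₁ : ∀ x ∈ Set.Icc (-1 : ℝ) 1, z₁ ≠ x) (hz₂ : ∀ x ∈ Set.Icc (-1 : ℝ) 1, z₂ ≠ x)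
    (hw₁ : w₁ ^ 2 = z₁ ^ 2 - 1) (hl₁ : ‖z₁ - w₁‖ < 1)
    (hw₂ : w₂ ^ 2 = z₂ ^ 2 - 1) (hl₂ : ‖z₂ - w₂‖ < 1) (hne : z₁ ≠ z₂) :
    ∫ θ in (0 : ℝ)..2 * Real.pi, (3 * (Real.cos θ : ℂ) ^ 2 + p * Real.cos θ + q) /
        (3 * (Real.cos θ - z₁) * (Real.cos θ - z₂)) =
      2 * Real.pi * (1 - ((3 * z₂ ^ 2 + p * z₂ + q) / w₂ - (3 * z₁ ^ 2 + p * z₁ + q) / w₁) /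
        (3 * (z₂ - z₁))) := by
  have h21 : z₂ - z₁ ≠ 0 := sub_ne_zero.2 hne.symm
  have hpf : ∀ θ : ℝ, (3 * (Real.cos θ : ℂ) ^ 2 + p * Real.cos θ + q) /
        (3 * (Real.cos θ - z₁) * (Real.cos θ - z₂)) =
      1 + ((3 * z₁ ^ 2 + p * z₁ + q) / (3 * (z₂ - z₁)) * (z₁ - Real.cos θ)⁻¹ -
        (3 * z₂ ^ 2 + p * z₂ + q) / (3 * (z₂ - z₁)) * (z₂ - Real.cos θ)⁻¹) := by
    intro θ
    have e1 : z₁ - (Real.cos θ : ℂ) ≠ 0 := sub_ne_zero.2 (hz₁ _ (Real.cos_mem_Icc θ))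
    have e2 : z₂ - (Real.cos θ : ℂ) ≠ 0 := sub_ne_zero.2 (hz₂ _ (Real.cos_mem_Icc θ))
    rw [← neg_sub z₁ (Real.cos θ : ℂ), ← neg_sub z₂ (Real.cos θ : ℂ)]
    field_simp
    ring
  have c1 := continuous_inv_sub_cos_pow hz₁ 1
  have c2 := continuous_inv_sub_cos_pow hz₂ 1
  simp only [pow_one] at c1 c2
  have i1 := (c1.const_mul ((3 * z₁ ^ 2 + p * z₁ + q) / (3 * (z₂ - z₁)))).intervalIntegrable
    (μ := volume) 0 (2 * Real.pi)
  have i2 := (c2.const_mul ((3 * z₂ ^ 2 + p * z₂ + q) / (3 * (z₂ - z₁)))).intervalIntegrable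
    (μ := volume) 0 (2 * Real.pi)
  simp_rw [hpf]
  rw [intervalIntegral.integral_add intervalIntegrable_const (i1.sub i2),
    intervalIntegral.integral_sub i1 i2, intervalIntegral.integral_const_mul,
    intervalIntegral.integral_const_mul, integral_inv_sub_cos hw₁ hl₁,
    integral_inv_sub_cos hw₂ hl₂, intervalIntegral.integral_const]
  simp only [sub_zero, Complex.real_smul, Complex.ofReal_mul, Complex.ofReal_ofNat, mul_one]
  ring

theorem integral_quadratic_div_sq {z w : ℂ} (p q : ℂ)
    (hz : ∀ x ∈ Set.Icc (-1 : ℝ) 1, z ≠ x)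
    (hw : w ^ 2 = z ^ 2 - 1) (hl : ‖z - w‖ < 1) :
    ∫ θ in (0 : ℝ)..2 * Real.pi, (3 * (Real.cos θ : ℂ) ^ 2 + p * Real.cos θ + q) /
        (3 * (Real.cos θ - z) * (Real.cos θ - z)) =
      2 * Real.pi * (1 - ((6 * z + p) / w - (3 * z ^ 2 + p * z + q) * z / w ^ 3) / 3) := by
  have hpf : ∀ θ : ℝ, (3 * (Real.cos θ : ℂ) ^ 2 + p * Real.cos θ + q) /
        (3 * (Real.cos θ - z) * (Real.cos θ - z)) =
      1 + ((3 * z ^ 2 + p * z + q) / 3 * ((z - Real.cos θ) ^ 2)⁻¹ -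
        (6 * z + p) / 3 * (z - Real.cos θ)⁻¹) := by
    intro θ
    have e1 : z - (Real.cos θ : ℂ) ≠ 0 := sub_ne_zero.2 (hz _ (Real.cos_mem_Icc θ))
    rw [← neg_sub z (Real.cos θ : ℂ)]
    field_simp
    ring
  have c1 := continuous_inv_sub_cos_pow hz 1
  simp only [pow_one] at c1
  have i1 := (c1.const_mul ((6 * z + p) / 3)).intervalIntegrable
    (μ := volume) 0 (2 * Real.pi)
  have i2 := ((continuous_inv_sub_cos_pow hz 2).const_mul
    ((3 * z ^ 2 + p * z + q) / 3)).intervalIntegrable (μ := volume) 0 (2 * Real.pi)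
  simp_rw [hpf]
  rw [intervalIntegral.integral_add intervalIntegrable_const (i2.sub i1),
    intervalIntegral.integral_sub i2 i1, intervalIntegral.integral_const_mul,
    intervalIntegral.integral_const_mul, integral_inv_sub_cos hw hl,
    integral_inv_sub_cos_sq hw hl, intervalIntegral.integral_const]
  simp only [sub_zero, Complex.real_smul, Complex.ofReal_mul, Complex.ofReal_ofNat, mul_one]
  ring

/-- The reciprocal `1 / L`, as a function of `α`, `c = cos (ξ / 2)` and `Y`. -/
noncomputable def recipKernel (α c : ℝ) (Y : ℂ) : ℂ :=
  1 - (2 * Real.pi : ℂ)⁻¹ *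
    ∫ θ in (0 : ℝ)..2 * Real.pi, symF α c Y (Real.cos θ) / disp α c Y (Real.cos θ)

/-! ### The inertia term and the identification of the kernel -/

theorem inertia_eq (m μ₂ V ε ξ : ℝ) : inertia m μ₂ V ε ξ =
    ((m / μ₂ * (ε ^ 2 - (ξ * V) ^ 2) : ℝ) : ℂ) + ((m / μ₂ * (2 * ε * (ξ * V)) : ℝ) : ℂ) * Complex.I := by
  unfold inertia
  push_cast
  linear_combination (m / μ₂ * (ξ * V) ^ 2 : ℂ) * Complex.I_sq

theorem inertia_re (m μ₂ V ε ξ : ℝ) :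
    (inertia m μ₂ V ε ξ).re = m / μ₂ * (ε ^ 2 - (ξ * V) ^ 2) := by
  rw [inertia_eq]; simp only [Complex.add_re, Complex.re_ofReal_mul, Complex.ofReal_re,
    Complex.I_re, mul_zero, add_zero]

theorem inertia_im (m μ₂ V ε ξ : ℝ) :
    (inertia m μ₂ V ε ξ).im = m / μ₂ * (2 * ε * (ξ * V)) := by
  rw [inertia_eq]; simp only [Complex.add_im, Complex.im_ofReal_mul, Complex.ofReal_im,
    Complex.I_im, mul_one, zero_add]

theorem inertia_mem_slitPlane {m μ₂ V ε : ℝ} (hm : 0 < m) (hμ₂ : 0 < μ₂) (hV : 0 < V)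
    (hε : 0 < ε) (ξ : ℝ) : inertia m μ₂ V ε ξ ∈ Complex.slitPlane := by
  rw [Complex.mem_slitPlane_iff, inertia_re, inertia_im]
  rcases eq_or_ne ξ 0 with rfl | hξ
  · left
    simp
    positivity
  · right
    positivity

theorem symF_eq_Ffun (m μ₁ μ₂ V ε ξ x : ℝ) :
    symF (μ₁ / μ₂) (Real.cos (ξ / 2)) (inertia m μ₂ V ε ξ) x = Ffun m μ₁ μ₂ V ε ξ x := by
  unfold symF symF₁ symF₀ Ffun
  have h := Complex.sin_sq_add_cos_sq ((ξ : ℂ) / 2)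
  push_cast
  rw [show Complex.sin ((ξ : ℂ) / 2) ^ 2 = 1 - Complex.cos ((ξ : ℂ) / 2) ^ 2 by
    linear_combination h]
  ring

theorem Ffun_eq_quadratic (m μ₁ μ₂ V ε ξ : ℝ) : ∃ p q : ℂ, ∀ z : ℂ,
    Ffun m μ₁ μ₂ V ε ξ z = 3 * z ^ 2 + p * z + q := by
  let c : ℂ := Complex.cos (ξ / 2)
  let s : ℂ := 6 * (μ₁ / μ₂ : ℂ) * Complex.sin (ξ / 2) ^ 2 * (1 + c)
  let Y : ℂ := inertia m μ₂ V ε ξ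
  refine ⟨-6 * c - s - Y * (1 + 2 * c), 3 * c ^ 2 + s + Y * (2 + c), fun z => ?_⟩
  simp only [Ffun, c, s, Y]
  ring

/-- Only the square of the root of `disc` enters, so its branch is immaterial. -/
theorem disp_eq_mul (m μ₁ μ₂ V ε ξ x : ℝ) :
    disp (μ₁ / μ₂) (Real.cos (ξ / 2)) (inertia m μ₂ V ε ξ) x =
      3 * (x - zfun m μ₁ μ₂ V ε 1 ξ) * (x - zfun m μ₁ μ₂ V ε 2 ξ) := by
  have h := Complex.sin_sq_add_cos_sq ((ξ : ℂ) / 2)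
  have hs : Complex.sin ((ξ : ℂ) / 2) ^ 2 = 1 - Complex.cos ((ξ : ℂ) / 2) ^ 2 := by
    linear_combination h
  have hd := complex_sqrt_sq (disc m μ₁ μ₂ V ε ξ)
  unfold zfun
  set D := Complex.sqrt (disc m μ₁ μ₂ V ε ξ)
  unfold disc at hd
  simp only [hs] at hd ⊢
  unfold disp traceD detD
  push_cast
  linear_combination 3 * hd

theorem hasDerivAt_quadratic (p q z : ℂ) :
    HasDerivAt (fun z : ℂ => 3 * z ^ 2 + p * z + q) (6 * z + p) z := by
  have h := ((((hasDerivAt_id z).pow 2).const_mul (3 : ℂ)).add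
    ((hasDerivAt_id z).const_mul p)).add_const q
  refine h.congr_deriv ?_
  simp only [id]
  push_cast
  ring

theorem kernel_eq_inv_recipKernel {m μ₁ μ₂ V ε : ℝ} (hm : 0 < m) (hμ₁ : 0 < μ₁) (hμ₂ : 0 < μ₂)
    (hV : 0 < V) (hε : 0 < ε) (ξ : ℝ) : kernel m μ₁ μ₂ V ε ξ =
      (recipKernel (μ₁ / μ₂) (Real.cos (ξ / 2)) (inertia m μ₂ V ε ξ))⁻¹ := by
  -- Nonvanishing of `disp` on `[-1, 1]` keeps `z₁` and `z₂` off this segment, as the residue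
  -- formulas require.
  have hP : ∀ x ∈ Set.Icc (-1 : ℝ) 1,
      3 * (x - zfun m μ₁ μ₂ V ε 1 ξ) * (x - zfun m μ₁ μ₂ V ε 2 ξ) ≠ 0 := by
    intro x hx
    rw [← disp_eq_mul]
    exact disp_ne_zero (div_pos hμ₁ hμ₂).le (Real.cos_mem_Icc _) hx
      (inertia_mem_slitPlane hm hμ₂ hV hε ξ)
  obtain ⟨p, q, hF⟩ := Ffun_eq_quadratic m μ₁ μ₂ V ε ξ
  have hFd : ∀ z, deriv (Ffun m μ₁ μ₂ V ε ξ) z = 6 * z + p := by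
    intro z
    rw [show Ffun m μ₁ μ₂ V ε ξ = fun z : ℂ => 3 * z ^ 2 + p * z + q from funext hF]
    exact (hasDerivAt_quadratic p q z).deriv
  simp only [kernel, recipKernel, symF_eq_Ffun, disp_eq_mul, hFd, hF]
  generalize zfun m μ₁ μ₂ V ε 1 ξ = z₁ at hP ⊢
  generalize zfun m μ₁ μ₂ V ε 2 ξ = z₂ at hP ⊢
  have hz₁ : ∀ x ∈ Set.Icc (-1 : ℝ) 1, z₁ ≠ x := by
    rintro x hx rfl
    exact hP x hx (by simp)
  have hz₂ : ∀ x ∈ Set.Icc (-1 : ℝ) 1, z₂ ≠ x := by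
    rintro x hx rfl
    exact hP x hx (by simp)
  obtain ⟨hw₁, hl₁⟩ := rsign_mul_sqrt_spec hz₁
  obtain ⟨hw₂, hl₂⟩ := rsign_mul_sqrt_spec hz₂
  have hpi : (2 * Real.pi : ℂ) ≠ 0 := by simp [Real.pi_ne_zero]
  have hne0 : ∀ {z w : ℂ}, (∀ x ∈ Set.Icc (-1 : ℝ) 1, z ≠ x) → w ^ 2 = z ^ 2 - 1 → w ≠ 0 := by
    rintro z w hz hw rfl
    have hh : (z - 1) * (z + 1) = 0 := by linear_combination -hw
    rcases mul_eq_zero.1 hh with h | h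
    · exact hz 1 (by norm_num) (by simpa using sub_eq_zero.1 h)
    · exact hz (-1) (by norm_num) (by simpa using eq_neg_of_add_eq_zero_left h)
  split_ifs with heq
  · subst heq
    rw [integral_quadratic_div_sq p q hz₁ hw₁ hl₁, inv_mul_cancel_left₀ hpi]
    have h0 := hne0 hz₁ hw₁
    generalize rsign (lamStar z₁) * Complex.sqrt (z₁ ^ 2 - 1) = w at h0 ⊢
    rw [← inv_div]
    congr 1
    field_simp
    ring
  · rw [integral_quadratic_div_of_ne p q hz₁ hz₂ hw₁ hl₁ hw₂ hl₂ heq, inv_mul_cancel_left₀ hpi]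
    have h1 := hne0 hz₁ hw₁
    have h2 := hne0 hz₂ hw₂
    have h21 : z₂ - z₁ ≠ 0 := sub_ne_zero.2 (Ne.symm heq)
    rw [← inv_div]
    congr 1
    generalize rsign (lamStar z₁) = r₁ at *
    generalize rsign (lamStar z₂) = r₂ at *
    obtain ⟨a1, b1⟩ := mul_ne_zero_iff.1 h1
    obtain ⟨a2, b2⟩ := mul_ne_zero_iff.1 h2
    field_simp
    ring

/-! ### Continuity and conjugation symmetry of the reciprocal kernel -/

theorem continuous_symF_div_disp {α : ℝ} (hα : 0 ≤ α) {X : Type*} [TopologicalSpace X]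
    {c : X → ℝ} {Y : X → ℂ} {x : X → ℝ} (hc : Continuous c) (hY : Continuous Y)
    (hx : Continuous x) (hc1 : ∀ a, c a ∈ Set.Icc (-1 : ℝ) 1)
    (hx1 : ∀ a, x a ∈ Set.Icc (-1 : ℝ) 1) (hYs : ∀ a, Y a ∈ Complex.slitPlane) :
    Continuous fun a => symF α (c a) (Y a) (x a) / disp α (c a) (Y a) (x a) := by
  refine Continuous.div ?_ ?_ fun a => disp_ne_zero hα (hc1 a) (hx1 a) (hYs a)
  · unfold symF symF₁ symF₀
    fun_prop
  · unfold disp traceD detD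
    fun_prop

theorem continuous_symF_div_disp_cos {α c : ℝ} (hα : 0 ≤ α) (hc : c ∈ Set.Icc (-1 : ℝ) 1) {Y : ℂ}
    (hY : Y ∈ Complex.slitPlane) :
    Continuous fun θ : ℝ => symF α c Y (Real.cos θ) / disp α c Y (Real.cos θ) :=
  continuous_symF_div_disp hα continuous_const continuous_const Real.continuous_cos
    (fun _ => hc) Real.cos_mem_Icc (fun _ => hY)

theorem continuous_recipKernel {α : ℝ} (hα : 0 ≤ α) {c : ℝ → ℝ} {Y : ℝ → ℂ} (hc : Continuous c)
    (hY : Continuous Y) (hc1 : ∀ a, c a ∈ Set.Icc (-1 : ℝ) 1)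
    (hYs : ∀ a, Y a ∈ Complex.slitPlane) : Continuous fun ξ => recipKernel α (c ξ) (Y ξ) := by
  unfold recipKernel
  have h : Continuous (Function.uncurry fun ξ θ : ℝ =>
      symF α (c ξ) (Y ξ) (Real.cos θ) / disp α (c ξ) (Y ξ) (Real.cos θ)) :=
    continuous_symF_div_disp hα (c := fun a : ℝ × ℝ => c a.1) (Y := fun a => Y a.1)
      (x := fun a => Real.cos a.2) (by fun_prop) (by fun_prop) (by fun_prop)
      (fun a => hc1 a.1) (fun a => Real.cos_mem_Icc a.2) (fun a => hYs a.1)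
  have := intervalIntegral.continuous_parametric_intervalIntegral_of_continuous' (μ := volume)
    h 0 (2 * Real.pi)
  fun_prop

theorem recipKernel_conj (α c : ℝ) (Y : ℂ) :
    recipKernel α c ((starRingEnd ℂ) Y) = (starRingEnd ℂ) (recipKernel α c Y) := by
  unfold recipKernel
  rw [map_sub, map_mul, ← intervalIntegral.intervalIntegral_conj]
  simp [symF, disp, map_ofNat]

/-! ### The reciprocal kernel avoids the negative real axis -/

theorem im_recipKernel {α c : ℝ} (hα : 0 ≤ α) (hc : c ∈ Set.Icc (-1 : ℝ) 1) {Y : ℂ}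
    (hY : Y ∈ Complex.slitPlane) : (recipKernel α c Y).im = -((2 * Real.pi)⁻¹ *
      ∫ θ in (0 : ℝ)..2 * Real.pi, (symF α c Y (Real.cos θ) / disp α c Y (Real.cos θ)).im) := by
  have h := Complex.imCLM.intervalIntegral_comp_comm
    ((continuous_symF_div_disp_cos hα hc hY).intervalIntegrable (μ := volume) 0 (2 * Real.pi))
  simp only [Complex.imCLM_apply] at h
  rw [h, recipKernel, Complex.sub_im, Complex.one_im, zero_sub]
  congr 1
  rw [show (2 * Real.pi : ℂ)⁻¹ = (((2 * Real.pi)⁻¹ : ℝ) : ℂ) by push_cast; rfl,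
    Complex.im_ofReal_mul]

theorem im_div_eq (a b : ℂ) : (a / b).im = (a * (starRingEnd ℂ) b).im / Complex.normSq b := by
  rw [div_eq_mul_inv, Complex.inv_def, ← mul_assoc, Complex.im_mul_ofReal, div_eq_mul_inv]

theorem im_recipKernel_mul_im_pos {α c : ℝ} (hα : 0 ≤ α) (hc : c ∈ Set.Icc (-1 : ℝ) 1) {Y : ℂ}
    (hY : Y.im ≠ 0) : 0 < (recipKernel α c Y).im * Y.im := by
  have hYs : Y ∈ Complex.slitPlane := Complex.mem_slitPlane_iff.2 (Or.inr hY)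
  have hpos : 0 < ∫ θ in (0 : ℝ)..2 * Real.pi,
      -((symF α c Y (Real.cos θ) / disp α c Y (Real.cos θ)).im * Y.im) := by
    refine intervalIntegral.integral_pos (by positivity) ?_ ?_ ?_
    · have := Complex.continuous_im.comp (continuous_symF_div_disp_cos hα hc hYs)
      exact (this.mul continuous_const).neg.continuousOn
    · intro θ _
      rw [im_div_eq, div_mul_eq_mul_div, neg_nonneg]
      exact div_nonpos_of_nonpos_of_nonneg
        (im_symF_mul_conj_disp_mul_im_nonpos hc (Real.cos_mem_Icc θ) Y) (Complex.normSq_nonneg _)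
    -- Strictness needs one point: at `cos θ = 0`, `symF₁ = 2 + c > 0`.
    · refine ⟨Real.pi / 2, ⟨by positivity, by linarith [Real.pi_pos]⟩, ?_⟩
      have hx := Real.cos_mem_Icc (Real.pi / 2)
      have hf : 0 < symF₁ c (Real.cos (Real.pi / 2)) := by
        rw [Real.cos_pi_div_two, symF₁]
        linarith [hc.1]
      rw [im_div_eq, div_mul_eq_mul_div, neg_pos]
      refine div_neg_of_neg_of_pos ?_ (Complex.normSq_pos.2 (disp_ne_zero hα hc hx hYs))
      rw [im_symF_mul_conj_disp]
      nlinarith [mul_pos (nevanlinna_factor_pos (α := α) (X := Y.re) hc hx hY hf)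
        (show 0 < Y.im ^ 2 by positivity)]
  rw [intervalIntegral.integral_neg, intervalIntegral.integral_mul_const] at hpos
  rw [im_recipKernel hα hc hYs]
  have := mul_pos (show 0 < (2 * Real.pi)⁻¹ by positivity) hpos
  linarith

/-- Covers `ξ = 0`, where the imaginary part is uninformative. At `c = 1` the factor `y + (1 - x)`
cancels, leaving the mean of `y / (y + 3 (1 - cos θ))`. -/
theorem recipKernel_one_mem_slitPlane (α : ℝ) {y : ℝ} (hy : 0 < y) :
    recipKernel α 1 y ∈ Complex.slitPlane := by
  have hden : ∀ θ : ℝ, 0 < y + 3 * (1 - Real.cos θ) := fun θ => by linarith [Real.cos_le_one θ]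
  have hint : ∀ θ : ℝ, symF α 1 y (Real.cos θ) / disp α 1 y (Real.cos θ) =
      ((1 - y / (y + 3 * (1 - Real.cos θ)) : ℝ) : ℂ) := by
    intro θ
    have h1 : y + (1 - Real.cos θ) ≠ 0 := by linarith [hden θ, Real.cos_le_one θ]
    have hP : (disp α 1 y (Real.cos θ)) =
        (((y + (1 - Real.cos θ)) * (y + 3 * (1 - Real.cos θ)) : ℝ) : ℂ) := by
      unfold disp traceD detD
      push_cast
      ring
    have hF : (symF α 1 y (Real.cos θ)) =
        ((3 * (1 - Real.cos θ) * (y + (1 - Real.cos θ)) : ℝ) : ℂ) := by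
      unfold symF symF₁ symF₀
      push_cast
      ring
    rw [hP, hF, ← Complex.ofReal_div, Complex.ofReal_inj]
    have h2 := (hden θ).ne'
    field_simp
    ring
  have hcont : Continuous fun θ : ℝ => y / (y + 3 * (1 - Real.cos θ)) :=
    Continuous.div (by fun_prop) (by fun_prop) fun θ => (hden θ).ne'
  have hpos : 0 < ∫ θ in (0 : ℝ)..2 * Real.pi, y / (y + 3 * (1 - Real.cos θ)) :=
    intervalIntegral.intervalIntegral_pos_of_pos (hcont.intervalIntegrable _ _)
      (fun θ => div_pos hy (hden θ)) (by positivity)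
  have hval : recipKernel α 1 y = (((2 * Real.pi)⁻¹ *
      ∫ θ in (0 : ℝ)..2 * Real.pi, y / (y + 3 * (1 - Real.cos θ)) : ℝ) : ℂ) := by
    unfold recipKernel
    simp_rw [hint]
    rw [intervalIntegral.integral_ofReal, intervalIntegral.integral_sub intervalIntegrable_const
      (hcont.intervalIntegrable _ _), intervalIntegral.integral_const]
    simp only [sub_zero, smul_eq_mul, mul_one]
    push_cast
    have hpi : (Real.pi : ℂ) ≠ 0 := by simp [Real.pi_ne_zero]
    field_simp
    ring
  rw [hval, Complex.ofReal_mem_slitPlane]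
  positivity

/-! ### Behaviour for large inertia -/

/-- The threshold makes the leading powers of `Y` dominate: the numerator is at most `7 ‖Y‖`, the
denominator at least `‖Y‖² / 2`, whence 14. -/
theorem norm_symF_div_disp_le {α c x : ℝ} (hα : 0 ≤ α) (hc : c ∈ Set.Icc (-1 : ℝ) 1)
    (hx : x ∈ Set.Icc (-1 : ℝ) 1) {Y : ℂ} (hY : 48 * (α + 1) ≤ ‖Y‖) :
    ‖symF α c Y x / disp α c Y x‖ ≤ 14 / ‖Y‖ := by
  have hs0 := one_sub_sq_nonneg_of_mem_Icc hc
  have hs1 : 1 - c ^ 2 ≤ 1 := by nlinarith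
  have hcx0 := mul_le_one_of_mem_Icc hc hx
  have hcx : -1 ≤ c * x := by
    have := mul_le_one_of_mem_Icc hc (x := -x) ⟨by linarith [hx.2], by linarith [hx.1]⟩
    linarith
  have has : α * (1 - c ^ 2) ≤ α := by nlinarith
  have has0 : 0 ≤ α * (1 - c ^ 2) := mul_nonneg hα hs0
  have hsq : (c - x) ^ 2 ≤ 4 := by
    have h1 : |c - x| ≤ 2 := abs_le.2 ⟨by linarith [hc.1, hx.2], by linarith [hc.2, hx.1]⟩
    nlinarith [abs_nonneg (c - x), sq_abs (c - x)]
  have hcx4 : (1 + c) * (1 - x) ≤ 4 := by nlinarith [hc.1, hc.2, hx.1, hx.2]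
  have hcx40 : 0 ≤ (1 + c) * (1 - x) := mul_nonneg (by linarith [hc.1]) (by linarith [hx.2])
  have ht : traceD α c x ≤ 4 * α + 8 := by unfold traceD; linarith
  have hd : detD α c x ≤ 24 * α + 12 := by
    unfold detD
    nlinarith [mul_le_mul has (show 1 - c * x ≤ 2 by linarith) (by linarith) hα]
  have hf1 : symF₁ c x ≤ 6 := by unfold symF₁; linarith
  have hf0 : symF₀ α c x ≤ 24 * α + 12 := by
    unfold symF₀
    nlinarith [mul_le_mul has hcx4 hcx40 hα]
  have ht0 := traceD_nonneg hα hc hx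
  have hd0 := detD_nonneg hα hc hx
  have hf10 := symF₁_nonneg hc hx
  have hf00 := symF₀_nonneg hα hc hx
  have hY0 : 0 < ‖Y‖ := by linarith
  have hF : ‖symF α c Y x‖ ≤ 7 * ‖Y‖ := by
    unfold symF
    refine (norm_add_le _ _).trans ?_
    rw [norm_mul, Complex.norm_real, Complex.norm_real, Real.norm_of_nonneg hf10,
      Real.norm_of_nonneg hf00]
    nlinarith
  have hP : ‖Y‖ ^ 2 / 2 ≤ ‖disp α c Y x‖ := by
    have h1 : ‖Y ^ 2‖ ≤ ‖disp α c Y x‖ + ‖(traceD α c x : ℂ) * Y + detD α c x‖ := by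
      rw [show Y ^ 2 = disp α c Y x - ((traceD α c x : ℂ) * Y + detD α c x) by unfold disp; ring]
      exact norm_sub_le _ _
    have h2 := norm_add_le ((traceD α c x : ℂ) * Y) (detD α c x)
    rw [norm_mul, Complex.norm_real, Complex.norm_real, Real.norm_of_nonneg ht0,
      Real.norm_of_nonneg hd0] at h2
    rw [norm_pow] at h1
    nlinarith
  rw [norm_div, div_le_div_iff₀ (lt_of_lt_of_le (by positivity) hP) hY0]
  nlinarith

theorem norm_recipKernel_sub_one_le {α c : ℝ} (hα : 0 ≤ α) (hc : c ∈ Set.Icc (-1 : ℝ) 1)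
    {Y : ℂ} (hY : 48 * (α + 1) ≤ ‖Y‖) : ‖recipKernel α c Y - 1‖ ≤ 14 / ‖Y‖ := by
  have h := intervalIntegral.norm_integral_le_of_norm_le_const (a := 0) (b := 2 * Real.pi)
    (f := fun θ : ℝ => symF α c Y (Real.cos θ) / disp α c Y (Real.cos θ)) (C := 14 / ‖Y‖)
    fun θ _ => norm_symF_div_disp_le hα hc (Real.cos_mem_Icc θ) hY
  have hpi : (0 : ℝ) < 2 * Real.pi := by positivity
  rw [sub_zero, abs_of_pos hpi] at h
  unfold recipKernel
  rw [sub_sub_cancel_left, norm_neg, norm_mul, norm_inv,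
    show ‖(2 * Real.pi : ℂ)‖ = 2 * Real.pi by simpa using Real.pi_pos.le,
    inv_mul_le_iff₀ hpi]
  linarith

/-! ### The Cauchy integral and its jump -/

/-- Differentiation under the integral: on a ball of radius `|Im ζ₀| / 2` the distance to the real
line stays at least `|Im ζ₀| / 2`. -/
theorem differentiableAt_cauchyIntegral {ℓ : ℝ → ℂ} (hℓ : Integrable ℓ) {ζ₀ : ℂ}
    (hζ₀ : ζ₀.im ≠ 0) : DifferentiableAt ℂ (cauchyIntegral ℓ) ζ₀ := by
  have hr : 0 < |ζ₀.im| / 2 := by positivity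
  have hdist : ∀ ζ ∈ Metric.ball ζ₀ (|ζ₀.im| / 2), ∀ s : ℝ, |ζ₀.im| / 2 ≤ ‖(s : ℂ) - ζ‖ := by
    intro ζ hζ s
    have h1 : |ζ.im - ζ₀.im| < |ζ₀.im| / 2 := by
      have := Complex.abs_im_le_norm (ζ - ζ₀)
      rw [Complex.sub_im] at this
      exact this.trans_lt (by simpa [dist_eq_norm] using hζ)
    have h2 : |ζ.im| ≤ ‖(s : ℂ) - ζ‖ := by
      simpa using Complex.abs_im_le_norm ((s : ℂ) - ζ)
    have h3 := abs_sub_abs_le_abs_sub ζ₀.im ζ.im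
    rw [abs_sub_comm] at h3
    linarith
  have hne : ∀ ζ ∈ Metric.ball ζ₀ (|ζ₀.im| / 2), ∀ s : ℝ, (s : ℂ) - ζ ≠ 0 := fun ζ hζ s h => by
    have := hdist ζ hζ s
    rw [h, norm_zero] at this
    linarith
  have hmeas : ∀ n : ℕ, ∀ ζ : ℂ, AEStronglyMeasurable (fun s : ℝ => ℓ s / ((s : ℂ) - ζ) ^ n) := by
    intro n ζ
    have h : Measurable fun s : ℝ => (((s : ℂ) - ζ) ^ n)⁻¹ := by fun_prop
    simp only [div_eq_mul_inv]
    exact hℓ.aestronglyMeasurable.mul h.aestronglyMeasurable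
  have hmem := Metric.mem_ball_self (x := ζ₀) hr
  have key := (hasDerivAt_integral_of_dominated_loc_of_deriv_le (μ := volume) (𝕜 := ℂ)
    (F := fun ζ (s : ℝ) => ℓ s / ((s : ℂ) - ζ)) (F' := fun ζ s => ℓ s / ((s : ℂ) - ζ) ^ 2)
    (bound := fun s => ‖ℓ s‖ * ((|ζ₀.im| / 2) ^ 2)⁻¹)
    (Metric.ball_mem_nhds ζ₀ hr) (Eventually.of_forall fun ζ => by simpa using hmeas 1 ζ)
    ?_ (hmeas 2 ζ₀) ?_ (hℓ.norm.mul_const _) ?_).2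
  · unfold cauchyIntegral
    exact key.differentiableAt.const_mul _
  · refine (hℓ.norm.mul_const (|ζ₀.im| / 2)⁻¹).mono' (by simpa using hmeas 1 ζ₀)
      (Eventually.of_forall fun s => ?_)
    rw [norm_div, div_eq_mul_inv]
    gcongr
    exact hdist ζ₀ hmem s
  · refine Eventually.of_forall fun s ζ hζ => ?_
    rw [norm_div, norm_pow, div_eq_mul_inv]
    gcongr
    exact hdist ζ hζ s
  · refine Eventually.of_forall fun s ζ hζ => ?_
    have h := (((hasDerivAt_id ζ).const_sub (s : ℂ)).inv (hne ζ hζ s)).const_mul (ℓ s)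
    refine (h.congr_deriv ?_)
    simp [div_eq_mul_inv]

theorem integrable_div_sub {ℓ : ℝ → ℂ} (hℓ : Integrable ℓ) {ζ : ℂ} (hζ : ζ.im ≠ 0) :
    Integrable fun s : ℝ => ℓ s / ((s : ℂ) - ζ) := by
  have h : Measurable fun s : ℝ => ((s : ℂ) - ζ)⁻¹ := by fun_prop
  refine (hℓ.norm.mul_const |ζ.im|⁻¹).mono'
    (by simp only [div_eq_mul_inv]; exact hℓ.aestronglyMeasurable.mul h.aestronglyMeasurable)
    (Eventually.of_forall fun s => ?_)
  rw [norm_div, div_eq_mul_inv]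
  have : |ζ.im| ≤ ‖(s : ℂ) - ζ‖ := by simpa using Complex.abs_im_le_norm ((s : ℂ) - ζ)
  gcongr

/-- The difference of the Cauchy integral across the real line is a Poisson integral. -/
theorem cauchyIntegral_sub_cauchyIntegral {ℓ : ℝ → ℂ} (hℓ : Integrable ℓ) (ξ : ℝ) {δ : ℝ}
    (hδ : 0 < δ) : cauchyIntegral ℓ (ξ + Complex.I * δ) - cauchyIntegral ℓ (ξ - Complex.I * δ) =
      (Real.pi : ℂ)⁻¹ * ∫ u : ℝ, ((1 + u ^ 2)⁻¹ : ℝ) • ℓ (δ * u + ξ) := by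
  have hp : ((ξ : ℂ) + Complex.I * δ).im ≠ 0 := by simpa using hδ.ne'
  have hm : ((ξ : ℂ) - Complex.I * δ).im ≠ 0 := by simpa using hδ.ne'
  unfold cauchyIntegral
  rw [← mul_sub, ← integral_sub (integrable_div_sub hℓ hp) (integrable_div_sub hℓ hm)]
  -- Substitution `s = δ u + ξ`.
  have hchange : ∫ u : ℝ, ((1 + u ^ 2)⁻¹ : ℝ) • ℓ (δ * u + ξ) =
      ∫ s : ℝ, (δ⁻¹ : ℝ) • ((1 + ((s - ξ) / δ) ^ 2)⁻¹ : ℝ) • ℓ s := by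
    have h1 := integral_sub_right_eq_self
      (fun s : ℝ => (δ⁻¹ : ℝ) • ((1 + (s / δ) ^ 2)⁻¹ : ℝ) • ℓ (s + ξ)) (μ := volume) ξ
    simp only [sub_add_cancel] at h1
    rw [h1]
    have h2 := Measure.integral_comp_mul_left
      (fun s : ℝ => (δ⁻¹ : ℝ) • ((1 + (s / δ) ^ 2)⁻¹ : ℝ) • ℓ (s + ξ)) δ
    simp only [mul_div_cancel_left₀ _ hδ.ne'] at h2
    rw [integral_smul, abs_of_pos (inv_pos.2 hδ)] at h2
    exact smul_right_injective ℂ (inv_ne_zero hδ.ne') h2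
  rw [hchange, ← integral_const_mul, ← integral_const_mul]
  refine integral_congr_ae (Eventually.of_forall fun s => ?_)
  have e1 : (s : ℂ) - (ξ + Complex.I * δ) ≠ 0 := fun h => hδ.ne' (by
    simpa using congrArg Complex.im h)
  have e2 : (s : ℂ) - (ξ - Complex.I * δ) ≠ 0 := fun h => hδ.ne' (by
    simpa using congrArg Complex.im h)
  have e3 : (s - ξ) ^ 2 + δ ^ 2 ≠ 0 := by positivity
  have e4 : (1 + ((s - ξ) / δ) ^ 2)⁻¹ = δ ^ 2 / ((s - ξ) ^ 2 + δ ^ 2) := by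
    field_simp
    ring
  have e5 : ((s : ℂ) - (ξ + Complex.I * δ)) * ((s : ℂ) - (ξ - Complex.I * δ)) =
      (((s - ξ) ^ 2 + δ ^ 2 : ℝ) : ℂ) := by
    push_cast
    linear_combination -(δ : ℂ) ^ 2 * Complex.I_sq
  have hpi : (Real.pi : ℂ) ≠ 0 := by simp [Real.pi_ne_zero]
  have hδc : (δ : ℂ) ≠ 0 := by simpa using hδ.ne'
  have e3c : (((s - ξ) ^ 2 + δ ^ 2 : ℝ) : ℂ) ≠ 0 := by exact_mod_cast e3
  simp only [Complex.real_smul]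
  rw [e4, div_sub_div _ _ e1 e2, e5, Complex.ofReal_div, Complex.ofReal_inv]
  field_simp
  push_cast
  ring

/-- In the rescaled variable the kernel is fixed with mass `π`; dominated convergence applies with
majorant `C / (1 + u²)`. -/
theorem tendsto_poisson {ℓ : ℝ → ℂ} (hc : Continuous ℓ) {C : ℝ} (hC : ∀ s, ‖ℓ s‖ ≤ C) (ξ : ℝ) :
    Tendsto (fun δ : ℝ => (Real.pi : ℂ)⁻¹ * ∫ u : ℝ, ((1 + u ^ 2)⁻¹ : ℝ) • ℓ (δ * u + ξ))
      (𝓝[>] 0) (𝓝 (ℓ ξ)) := by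
  have hlim : Tendsto (fun δ : ℝ => ∫ u : ℝ, ((1 + u ^ 2)⁻¹ : ℝ) • ℓ (δ * u + ξ))
      (𝓝[>] 0) (𝓝 (∫ u : ℝ, ((1 + u ^ 2)⁻¹ : ℝ) • ℓ ξ)) := by
    refine tendsto_integral_filter_of_dominated_convergence (fun u => (1 + u ^ 2)⁻¹ * C)
      (Eventually.of_forall fun δ => ?_) (Eventually.of_forall fun δ =>
        Eventually.of_forall fun u => ?_) (integrable_inv_one_add_sq.mul_const C)
      (Eventually.of_forall fun u => ?_)
    · have h1 : Continuous fun u : ℝ => (1 + u ^ 2)⁻¹ :=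
        Continuous.inv₀ (by fun_prop) fun u => by positivity
      have h2 : Continuous fun u : ℝ => ℓ (δ * u + ξ) := by fun_prop
      exact (h1.smul h2).aestronglyMeasurable
    · rw [norm_smul, Real.norm_of_nonneg (by positivity)]
      gcongr
      exact hC _
    · refine Tendsto.const_smul ?_ _
      have h : Continuous fun δ : ℝ => ℓ (δ * u + ξ) := by fun_prop
      simpa using (h.tendsto 0).mono_left nhdsWithin_le_nhds
  rw [integral_smul_const, integral_univ_inv_one_add_sq] at hlim
  have hpi : (Real.pi : ℂ) ≠ 0 := by simp [Real.pi_ne_zero]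
  have := hlim.const_mul (Real.pi : ℂ)⁻¹
  rwa [Complex.real_smul, inv_mul_cancel_left₀ hpi] at this

theorem differentiableOn_factorPlus {ℓ : ℝ → ℂ} (hℓ : Integrable ℓ) :
    DifferentiableOn ℂ (factorPlus ℓ) {ζ : ℂ | 0 < ζ.im} := fun _ hζ =>
  (differentiableAt_cauchyIntegral hℓ (ne_of_gt hζ)).cexp.differentiableWithinAt

theorem differentiableOn_factorMinus {ℓ : ℝ → ℂ} (hℓ : Integrable ℓ) :
    DifferentiableOn ℂ (factorMinus ℓ) {ζ : ℂ | ζ.im < 0} := fun _ hζ =>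
  (differentiableAt_cauchyIntegral hℓ (ne_of_lt hζ)).neg.cexp.differentiableWithinAt

theorem tendsto_factorPlus_mul_factorMinus {ℓ : ℝ → ℂ} (hℓ : Integrable ℓ) (hc : Continuous ℓ)
    {C : ℝ} (hC : ∀ s, ‖ℓ s‖ ≤ C) (ξ : ℝ) :
    Tendsto (fun δ : ℝ => factorPlus ℓ ((ξ : ℂ) + Complex.I * δ) *
      factorMinus ℓ ((ξ : ℂ) - Complex.I * δ)) (𝓝[>] 0) (𝓝 (Complex.exp (ℓ ξ))) := by
  refine ((Complex.continuous_exp.tendsto _).comp (tendsto_poisson hc hC ξ)).congr' ?_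
  filter_upwards [self_mem_nhdsWithin] with δ hδ
  rw [Function.comp_apply, ← cauchyIntegral_sub_cauchyIntegral hℓ ξ hδ, factorPlus, factorMinus,
    ← Complex.exp_add, sub_eq_add_neg]

/-! ### The kernel -/

theorem exists_norm_le_of_tendsto_zero_cocompact {f : ℝ → ℂ} (hc : Continuous f)
    (h0 : Tendsto f (cocompact ℝ) (𝓝 0)) : ∃ C, ∀ s, ‖f s‖ ≤ C := by
  let g : ZeroAtInftyContinuousMap ℝ ℂ := ⟨⟨f, hc⟩, h0⟩
  obtain ⟨C, hC⟩ := (ZeroAtInftyContinuousMap.isBounded_range g).exists_norm_le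
  exact ⟨C, fun s => hC _ ⟨s, rfl⟩⟩

theorem continuous_inertia (m μ₂ V ε : ℝ) : Continuous (inertia m μ₂ V ε) := by
  unfold inertia
  fun_prop

theorem inertia_neg (m μ₂ V ε ξ : ℝ) :
    inertia m μ₂ V ε (-ξ) = (starRingEnd ℂ) (inertia m μ₂ V ε ξ) := by
  apply Complex.ext
  · simp only [inertia_re, Complex.conj_re]
    ring
  · simp only [inertia_im, Complex.conj_im]
    ring

theorem mul_sq_le_norm_inertia {m μ₂ : ℝ} (hm : 0 < m) (hμ₂ : 0 < μ₂) (V ε ξ : ℝ) :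
    m / μ₂ * V ^ 2 * ξ ^ 2 ≤ ‖inertia m μ₂ V ε ξ‖ := by
  have h : ‖(ε : ℂ) + Complex.I * ξ * V‖ ^ 2 = ε ^ 2 + (ξ * V) ^ 2 := by
    rw [← Complex.normSq_eq_norm_sq, Complex.normSq_apply]
    simp
    ring
  have hd : 0 < m / μ₂ := div_pos hm hμ₂
  unfold inertia
  rw [norm_mul, norm_pow, h, ← Complex.ofReal_div, Complex.norm_real, Real.norm_of_nonneg hd.le]
  nlinarith [mul_nonneg hd.le (sq_nonneg ε)]

theorem recipKernel_mem_slitPlane {m μ₁ μ₂ V ε : ℝ} (hm : 0 < m) (hμ₁ : 0 < μ₁) (hμ₂ : 0 < μ₂)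
    (hV : 0 < V) (hε : 0 < ε) (ξ : ℝ) :
    recipKernel (μ₁ / μ₂) (Real.cos (ξ / 2)) (inertia m μ₂ V ε ξ) ∈ Complex.slitPlane := by
  rcases eq_or_ne ξ 0 with rfl | hξ
  · have h : inertia m μ₂ V ε 0 = ((m / μ₂ * ε ^ 2 : ℝ) : ℂ) := by
      simp [inertia]
    rw [h, zero_div, Real.cos_zero]
    exact recipKernel_one_mem_slitPlane _ (by positivity)
  · have hY : (inertia m μ₂ V ε ξ).im ≠ 0 := by
      rw [inertia_im]
      positivity
    have h := im_recipKernel_mul_im_pos (div_pos hμ₁ hμ₂).le (Real.cos_mem_Icc (ξ / 2)) hY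
    exact Complex.mem_slitPlane_iff.2 (Or.inr (left_ne_zero_of_mul h.ne'))

end LatticeCrack

/-! ### Index and factorization of the kernel -/

open LatticeCrack in
theorem mainTheorem3 (m μ₁ μ₂ V ε : ℝ)
    (hm : 0 < m) (hμ₁ : 0 < μ₁) (hμ₂ : 0 < μ₂) (hV : 0 < V) (hε : 0 < ε) :
    Continuous (LatticeCrack.kernel m μ₁ μ₂ V ε) ∧
    LatticeCrack.kernel m μ₁ μ₂ V ε ∈ LatticeCrack.classJ ∧
    Tendsto (LatticeCrack.kernel m μ₁ μ₂ V ε) atBot (𝓝 1) ∧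
    Tendsto (LatticeCrack.kernel m μ₁ μ₂ V ε) atTop (𝓝 1) ∧
    LatticeCrack.HasIndex (LatticeCrack.kernel m μ₁ μ₂ V ε) 0 ∧
    ∃ ℓ : ℝ → ℂ,
      LatticeCrack.IsLogVanishingAtInfinity (LatticeCrack.kernel m μ₁ μ₂ V ε) ℓ ∧
      Integrable ℓ ∧
      DifferentiableOn ℂ (LatticeCrack.factorPlus ℓ) {ζ : ℂ | 0 < ζ.im} ∧
      DifferentiableOn ℂ (LatticeCrack.factorMinus ℓ) {ζ : ℂ | ζ.im < 0} ∧
      ∀ ξ : ℝ, Tendsto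
        (fun δ : ℝ => LatticeCrack.factorPlus ℓ ((ξ : ℂ) + Complex.I * δ) *
          LatticeCrack.factorMinus ℓ ((ξ : ℂ) - Complex.I * δ))
        (𝓝[>] 0) (𝓝 (LatticeCrack.kernel m μ₁ μ₂ V ε ξ)) := by
  have hα : 0 ≤ μ₁ / μ₂ := (div_pos hμ₁ hμ₂).le
  set R : ℝ → ℂ := fun ξ => recipKernel (μ₁ / μ₂) (Real.cos (ξ / 2)) (inertia m μ₂ V ε ξ) with hR
  have hK : kernel m μ₁ μ₂ V ε = fun ξ => (R ξ)⁻¹ :=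
    funext (kernel_eq_inv_recipKernel hm hμ₁ hμ₂ hV hε)
  have hRs : ∀ ξ, R ξ ∈ Complex.slitPlane := recipKernel_mem_slitPlane hm hμ₁ hμ₂ hV hε
  have hR0 : ∀ ξ, R ξ ≠ 0 := fun ξ => Complex.slitPlane_ne_zero (hRs ξ)
  have hRc : Continuous R := continuous_recipKernel hα (by fun_prop)
    (continuous_inertia m μ₂ V ε) (fun _ => Real.cos_mem_Icc _)
    (inertia_mem_slitPlane hm hμ₂ hV hε)
  set κ : ℝ := m / μ₂ * V ^ 2 with hκ
  have hκ0 : 0 < κ := by positivity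
  have hbig : Tendsto (fun ξ : ℝ => κ * ‖ξ‖ ^ 2) (cocompact ℝ) atTop :=
    ((tendsto_pow_atTop two_ne_zero).comp (tendsto_norm_cocompact_atTop (E := ℝ))).const_mul_atTop
      hκ0
  have hbound : ∀ᶠ ξ : ℝ in cocompact ℝ, ‖R ξ - 1‖ ≤ 14 / (κ * ξ ^ 2) := by
    filter_upwards [hbig.eventually_ge_atTop (48 * (μ₁ / μ₂ + 1))] with ξ hξ
    rw [Real.norm_eq_abs, sq_abs] at hξ
    have h1 := mul_sq_le_norm_inertia hm hμ₂ V ε ξ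
    refine (norm_recipKernel_sub_one_le hα (Real.cos_mem_Icc _) (hξ.trans h1)).trans ?_
    have h2 : 0 < κ * ξ ^ 2 := lt_of_lt_of_le (by positivity) hξ
    gcongr
  have hzero : Tendsto (fun ξ : ℝ => 14 / (κ * ξ ^ 2)) (cocompact ℝ) (𝓝 0) := by
    simpa using hbig.const_div_atTop 14
  have hR1 : Tendsto R (cocompact ℝ) (𝓝 1) := by
    rw [tendsto_iff_norm_sub_tendsto_zero]
    exact squeeze_zero' (Eventually.of_forall fun _ => norm_nonneg _) hbound hzero
  have hbot : (atBot : Filter ℝ) ≤ cocompact ℝ := atBot_le_cocompact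
  have htop : (atTop : Filter ℝ) ≤ cocompact ℝ := atTop_le_cocompact
  have hK1 : Tendsto (kernel m μ₁ μ₂ V ε) (cocompact ℝ) (𝓝 1) := by
    rw [hK]
    simpa using hR1.inv₀ one_ne_zero
  set ℓ : ℝ → ℂ := fun ξ => -Complex.log (R ξ) with hℓ
  have hℓc : Continuous ℓ := (hRc.clog hRs).neg
  have hℓexp : ∀ ξ, Complex.exp (ℓ ξ) = kernel m μ₁ μ₂ V ε ξ := fun ξ => by
    rw [hK, hℓ, Complex.exp_neg, Complex.exp_log (hR0 ξ)]
  have hℓ0 : Tendsto ℓ (cocompact ℝ) (𝓝 0) := by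
    simpa using (hR1.clog Complex.one_mem_slitPlane).neg
  have hℓim : Tendsto (fun ξ => (ℓ ξ).im) (cocompact ℝ) (𝓝 0) :=
    (Complex.continuous_im.tendsto 0).comp hℓ0
  obtain ⟨C, hC⟩ := exists_norm_le_of_tendsto_zero_cocompact hℓc hℓ0
  have hℓi : Integrable ℓ := by
    -- The constant is `42 = (3/2) * 14 * 2`: the logarithm bound, the decay bound, and `1 + ξ² ≤ 2
    -- ξ²` for `|ξ| ≥ 1`.
    refine hℓc.locallyIntegrable.integrable_of_isBigO_cocompact (g := fun ξ : ℝ => (1 + ξ ^ 2)⁻¹)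
      (Asymptotics.IsBigO.of_bound (42 / κ) ?_) (integrable_inv_one_add_sq.integrableAtFilter _)
    have hsmall := (tendsto_iff_norm_sub_tendsto_zero.1 hR1).eventually_le_const
      (show (0 : ℝ) < 1 / 2 by norm_num)
    have hlarge := (tendsto_norm_cocompact_atTop (E := ℝ)).eventually_ge_atTop 1
    filter_upwards [hbound, hsmall, hlarge] with ξ h1 h2 h3
    have h4 := Complex.norm_log_one_add_half_le_self h2
    rw [add_sub_cancel] at h4
    have h5 : 1 ≤ ξ ^ 2 := by
      rw [Real.norm_eq_abs] at h3
      rw [← sq_abs]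
      nlinarith
    rw [hℓ, norm_neg, Real.norm_of_nonneg (by positivity)]
    calc ‖Complex.log (R ξ)‖ ≤ 3 / 2 * (14 / (κ * ξ ^ 2)) := h4.trans (by gcongr)
      _ = 42 / κ * (2 * ξ ^ 2)⁻¹ := by field_simp; norm_num
      _ ≤ 42 / κ * (1 + ξ ^ 2)⁻¹ := by
        gcongr
        linarith
  -- The continuous argument is `Im ℓ`, with limit 0 at both ends.
  refine ⟨?_, ?_, hK1.mono_left hbot, hK1.mono_left htop, ⟨?_, fun ξ => (ℓ ξ).im, 0, 0, ⟨?_, ?_⟩,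
    ?_, ?_, ?_⟩, ℓ, ⟨hℓc, hℓexp, hℓ0.mono_left hbot, hℓ0.mono_left htop⟩, hℓi,
    differentiableOn_factorPlus hℓi, differentiableOn_factorMinus hℓi, fun ξ => ?_⟩
  · rw [hK]
    exact hRc.inv₀ hR0
  · intro ξ
    have h : kernel m μ₁ μ₂ V ε (-ξ) = (starRingEnd ℂ) (kernel m μ₁ μ₂ V ε ξ) := by
      rw [hK, hR]
      simp only
      rw [neg_div, Real.cos_neg, inertia_neg, recipKernel_conj, map_inv₀]
    rw [h]
    simp
  · intro ξ
    rw [hK]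
    exact inv_ne_zero (hR0 ξ)
  · exact Complex.continuous_im.comp hℓc
  · intro ξ
    rw [← hℓexp ξ, Complex.norm_exp, Complex.ofReal_exp, ← Complex.exp_add]
    congr 1
    rw [mul_comm, Complex.re_add_im]
  · exact hℓim.mono_left hbot
  · exact hℓim.mono_left htop
  · simp
  · rw [← hℓexp ξ]
    exact tendsto_factorPlus_mul_factorMinus hℓi hℓc hC ξ
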